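/- Let $k\ge 3$ and $r\ge 2$ be integers and let $\varepsilon>0$ be a real number. Then there exist $\mu>0$ and $n_0\in\mathbb{N}$ such that the following holds for every integer $n\ge n_0$ divisible by $k$. Let $G$ be a $k$-uniform hypergraph with exactly $n$ vertices such that every set of $k-1$ vertices is contained in at least $(1/2+\varepsilon)n$ edges of $G$, that is, whose minimum $(k-1)$-degree satisfies $\delta(G)\ge(1/2+\varepsilon)n$, and let every edge of $G$ be assigned one of $r$ colours. Then $G$ has a perfect matching (a set of pairwise disjoint edges covering all vertices of $G$) which contains at least $(1+\mu)\frac{n}{rk}$ edges of the same colour. -/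

import Mathlib

namespace Hypergraph

variable {α : Type*}

/-- A `k`-graph, that is, a `k`-uniform hypergraph: every edge consists of exactly `k` vertices. -/
def IsUniform (G : Hypergraph α) (k : ℕ) : Prop :=
  ∀ e ∈ G.edgeSet, e.encard = k

/-- The degree `d_G(S)` of a set `S` of vertices: the number of edges containing `S`
(used for hypergraphs with finitely many vertices). -/
noncomputable def setDegree (G : Hypergraph α) (S : Set α) : ℕ :=
  {e ∈ G.edgeSet | S ⊆ e}.ncard

/-- The minimum `m`-degree: the minimum of `d_G(S)` over all `m`-sets `S ⊆ V(G)`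
(it is `0` if there are no such sets). -/
noncomputable def minSetDegree (G : Hypergraph α) (m : ℕ) : ℕ :=
  sInf (G.setDegree '' {S | S ⊆ G.vertexSet ∧ S.encard = m})

/-- A perfect matching of `G`: a set of pairwise disjoint edges which cover all vertices. -/
def IsPerfectMatching (G : Hypergraph α) (M : Set (Set α)) : Prop :=
  M ⊆ G.edgeSet ∧ M.PairwiseDisjoint id ∧ ⋃₀ M = G.vertexSet

/-- The number of edges of `M` which receive colour `i` in the edge-colouring `c` of `G`. -/
noncomputable def colourCount (G : Hypergraph α) {r : ℕ} (c : G.edgeSet → Fin r)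
    (M : Set (Set α)) (i : Fin r) : ℕ :=
  {e : G.edgeSet | e.1 ∈ M ∧ c e = i}.ncard

end Hypergraph

/-! Fix a colour and let `f` be the indicator of that colour on edges. Either many small disjoint
sets can each be tiled in two ways with different numbers of edges of this colour, or there is
hardly any such freedom. Both cases produce a biased matching.

In the first case, linearly many gadgets of at most `3k` vertices are joined into one set `W` with
two tilings whose counts differ by at least `t`, where `t` is linear in `n`
(`exists_shift_or_balanced`). Removing `W` costs little codegree, so the rest has a perfect matching
(`exists_forall_tileable`). Completing it in the two ways gives perfect matchings in which one
colour shifts by `t`, and averaging over colours finds a large class in one of them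
(`exists_le_count_of_shift`).

Otherwise, for every colour, deleting few vertices leaves a hypergraph in which equal small vertex
sets always have equal weight (`Balanced`). Retiling two or three edges then shows that exchanging a
vertex `x` of an edge for `y` changes `f` by `g x - g y` for a potential `g`
(`Balanced.exists_potential`), so `f` is a constant plus a sum of potentials. As `f` takes only the
values 0 and 1 and `k ≥ 3`, the potential is constant apart from one vertex
(`Balanced.exists_const`). Over all colours, the edges avoiding a small set are monochromatic, so
any perfect matching is nearly monochromatic; this suffices because `r ≥ 2`.

The perfect matching theorem is proved by absorption. Divisibility leaves at most one `k`-set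
uncovered after an almost perfect tiling, so it is enough that each `k`-set is absorbed by a single
edge of the absorber. -/

namespace TilingBias

/-! ### Tilings and almost perfect matchings -/

open Finset

variable {α : Type*} [DecidableEq α]

/-- `M` is a set of pairwise disjoint members of `E` whose union is `X`. -/
structure Tiles (E : Finset (Finset α)) (X : Finset α) (M : Finset (Finset α)) : Prop where
  subset : M ⊆ E
  disj : (M : Set (Finset α)).PairwiseDisjoint id
  union : M.biUnion id = X

/-- The set `X` is a disjoint union of members of `E`. -/
def Tileable (E : Finset (Finset α)) (X : Finset α) : Prop := ∃ M, Tiles E X M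

/-- The vertices of `U` which extend `S` to a member of `E`. -/
def nbr (E : Finset (Finset α)) (U S : Finset α) : Finset α :=
  U.filter fun v => v ∉ S ∧ insert v S ∈ E

variable {E : Finset (Finset α)} {U X Y S W : Finset α} {M P Q : Finset (Finset α)} {k : ℕ}

lemma mem_nbr {v : α} : v ∈ nbr E U S ↔ v ∈ U ∧ v ∉ S ∧ insert v S ∈ E := by
  simp [nbr]

lemma nbr_subset : nbr E U S ⊆ U := filter_subset _ _

lemma Tiles.empty : Tiles E ∅ ∅ := ⟨by simp, by simp, by simp⟩

lemma Tiles.singleton {e : Finset α} (he : e ∈ E) : Tiles E e {e} :=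
  ⟨by simpa using he, by simp, by simp⟩

lemma Tiles.subset_of_mem (h : Tiles E X M) {e : Finset α} (he : e ∈ M) : e ⊆ X := by
  rw [← h.union]
  exact subset_biUnion_of_mem id he

lemma Tiles.disj_union (hP : Tiles E X P) (hQ : Tiles E Y Q) (hXY : Disjoint X Y) :
    Tiles E (X ∪ Y) (P ∪ Q) := by
  refine ⟨union_subset hP.subset hQ.subset, ?_, ?_⟩
  · rw [coe_union, Set.pairwiseDisjoint_union]
    refine ⟨hP.disj, hQ.disj, fun a ha b hb _ => ?_⟩
    exact hXY.mono (hP.subset_of_mem ha) (hQ.subset_of_mem hb)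
  · rw [union_biUnion, hP.union, hQ.union]

lemma Tiles.erase (h : Tiles E X M) {e : Finset α} (he : e ∈ M) : Tiles E (X \ e) (M.erase e) := by
  refine ⟨(erase_subset _ _).trans h.subset, h.disj.subset (by simp), ?_⟩
  ext v
  rw [← h.union]
  simp only [mem_biUnion, mem_erase, id, mem_sdiff]
  constructor
  · rintro ⟨f, ⟨hfe, hf⟩, hv⟩
    exact ⟨⟨f, hf, hv⟩, fun hve => disjoint_left.1 (h.disj hf he hfe) hv hve⟩
  · rintro ⟨⟨f, hf, hv⟩, hve⟩
    exact ⟨f, ⟨fun h' => hve (h' ▸ hv), hf⟩, hv⟩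

lemma Tiles.disjoint_tiles (hE : ∀ e ∈ E, e.card = k) (hk : 0 < k) (hP : Tiles E X P)
    (hQ : Tiles E Y Q) (hXY : Disjoint X Y) : Disjoint P Q := by
  rw [Finset.disjoint_left]
  intro e he he'
  have h1 := hE e (hP.subset he)
  obtain ⟨v, hv⟩ : e.Nonempty := by rw [← card_pos]; omega
  exact disjoint_left.1 hXY (hP.subset_of_mem he hv) (hQ.subset_of_mem he' hv)

lemma Tiles.sum_card_inter (h : Tiles E X M) (hY : Y ⊆ X) : ∑ e ∈ M, (Y ∩ e).card = Y.card := by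
  rw [← card_biUnion]
  · congr 1
    rw [← inter_eq_left.2 hY, ← h.union]
    ext v
    simp
    tauto
  · intro a ha b hb hab
    exact (h.disj ha hb hab).mono inter_subset_right inter_subset_right

lemma Tiles.card (hE : ∀ e ∈ E, e.card = k) (h : Tiles E X M) : X.card = k * M.card := by
  rw [← h.sum_card_inter Subset.rfl, sum_congr rfl (g := fun _ => k), sum_const, smul_eq_mul,
    mul_comm]
  intro e he
  rw [inter_eq_right.2 (h.subset_of_mem he), hE e (h.subset he)]

lemma Tileable.union (hX : Tileable E X) (hY : Tileable E Y) (h : Disjoint X Y) :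
    Tileable E (X ∪ Y) := by
  obtain ⟨P, hP⟩ := hX
  obtain ⟨Q, hQ⟩ := hY
  exact ⟨_, hP.disj_union hQ h⟩

lemma Tileable.edge {e : Finset α} (he : e ∈ E) : Tileable E e := ⟨_, .singleton he⟩

lemma card_nbr_le_add : (nbr E U S).card ≤ (nbr E (U \ W) S).card + W.card := by
  have : nbr E U S ⊆ nbr E (U \ W) S ∪ W := by
    intro v
    simp only [mem_union, mem_nbr, mem_sdiff]
    tauto
  exact (card_le_card this).trans (card_union_le _ _)

/-- If all `(k-1)`-sets have degree at least `|U|/2`, then all but fewer than `2(k-1)` vertices can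
be covered by disjoint edges. -/
theorem exists_tileable_card_sdiff_lt (hE : ∀ e ∈ E, e.card = k) (hk : 2 ≤ k)
    (hdeg : ∀ S ⊆ U, S.card = k - 1 → U.card ≤ 2 * (nbr E U S).card) :
    ∃ W ⊆ U, Tileable E W ∧ (U \ W).card < 2 * (k - 1) := by
  classical
  obtain ⟨W, hW, hmax⟩ := exists_max_image (U.powerset.filter (Tileable E)) card
    ⟨∅, by simpa using ⟨∅, Tiles.empty⟩⟩
  simp only [mem_filter, mem_powerset] at hW hmax
  refine ⟨W, hW.1, hW.2, ?_⟩
  by_contra! hlarge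
  obtain ⟨S₁, hS₁, hc₁⟩ := exists_subset_card_eq (s := U \ W) (n := k - 1) (by omega)
  obtain ⟨S₂, hS₂, hc₂⟩ := exists_subset_card_eq (s := (U \ W) \ S₁) (n := k - 1) (by
    rw [card_sdiff_of_subset hS₁]; omega)
  have hdis : Disjoint S₁ S₂ := (disjoint_sdiff_self_left.mono_left hS₂).symm
  have hS₂' : S₂ ⊆ U \ W := hS₂.trans sdiff_subset
  -- A neighbour outside `W` would give an edge disjoint from `W`, against maximality.
  have key : ∀ S ⊆ U \ W, nbr E U S ⊆ W := by
    intro S hS v hv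
    rw [mem_nbr] at hv
    by_contra hvW
    have hd : Disjoint W (insert v S) := by
      rw [disjoint_insert_right]
      exact ⟨hvW, disjoint_sdiff.mono_right hS⟩
    have := hmax (W ∪ insert v S) ⟨union_subset hW.1 (insert_subset hv.1 (hS.trans sdiff_subset)),
      hW.2.union (.edge hv.2.2) hd⟩
    rw [card_union_of_disjoint hd, hE _ hv.2.2] at this
    omega
  obtain ⟨M, hM⟩ := hW.2
  -- The two neighbourhoods have total size at least `|U| > |W|`, so some edge `e` of the tiling
  -- meets them more than `k` times. It then contains distinct neighbours of `S₁` and `S₂`, and `e`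
  -- can be traded for two edges, contradicting maximality.
  have hlt : ∑ e ∈ M, e.card < ∑ e ∈ M, ((nbr E U S₁ ∩ e).card + (nbr E U S₂ ∩ e).card) := by
    rw [sum_add_distrib, hM.sum_card_inter (key S₁ hS₁), hM.sum_card_inter (key S₂ hS₂')]
    have h3 : ∑ e ∈ M, e.card = W.card := by
      rw [← hM.sum_card_inter Subset.rfl]
      exact sum_congr rfl fun e he => by rw [inter_eq_right.2 (hM.subset_of_mem he)]
    have h1 := hdeg S₁ (hS₁.trans sdiff_subset) hc₁
    have h2 := hdeg S₂ (hS₂'.trans sdiff_subset) hc₂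
    have := card_sdiff_add_card_eq_card hW.1
    omega
  obtain ⟨e, he, hlt⟩ := exists_lt_of_sum_lt hlt
  have hek := hE e (hM.subset he)
  obtain ⟨z₁, hz₁, z₂, hz₂, hne⟩ : ∃ z₁ ∈ nbr E U S₁ ∩ e, ∃ z₂ ∈ nbr E U S₂ ∩ e, z₁ ≠ z₂ := by
    by_contra! hcon
    have a1 := card_le_card (inter_subset_right (s₁ := nbr E U S₁) (s₂ := e))
    have a2 := card_le_card (inter_subset_right (s₁ := nbr E U S₂) (s₂ := e))
    obtain ⟨y₁, hy₁⟩ : (nbr E U S₁ ∩ e).Nonempty := by rw [← card_pos]; omega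
    obtain ⟨y₂, hy₂⟩ : (nbr E U S₂ ∩ e).Nonempty := by rw [← card_pos]; omega
    have b1 : (nbr E U S₁ ∩ e).card ≤ 1 := card_le_one.2 fun a ha b hb => by
      rw [hcon a ha y₂ hy₂, hcon b hb y₂ hy₂]
    have b2 : (nbr E U S₂ ∩ e).card ≤ 1 := card_le_one.2 fun a ha b hb => by
      rw [← hcon y₁ hy₁ a ha, ← hcon y₁ hy₁ b hb]
    omega
  simp only [mem_inter, mem_nbr] at hz₁ hz₂
  have heW := hM.subset_of_mem he
  have hA : ∀ v ∈ U \ W, v ∉ W := fun v hv => (mem_sdiff.1 hv).2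
  have hd12 : Disjoint (insert z₁ S₁) (insert z₂ S₂) := by
    rw [disjoint_insert_left, disjoint_insert_right, mem_insert]
    refine ⟨?_, ?_, hdis⟩
    · rintro (h | h)
      · exact hne h
      · exact hA _ (hS₂' h) (heW hz₁.2)
    · intro h
      exact hA _ (hS₁ h) (heW hz₂.2)
  have hd : Disjoint (W \ e) (insert z₁ S₁ ∪ insert z₂ S₂) := by
    rw [Finset.disjoint_left]
    intro v hv
    simp only [mem_sdiff, mem_union, mem_insert] at hv ⊢
    rintro ((rfl | h) | (rfl | h))
    · exact hv.2 hz₁.2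
    · exact hA _ (hS₁ h) hv.1
    · exact hv.2 hz₂.2
    · exact hA _ (hS₂' h) hv.1
  have := hmax ((W \ e) ∪ (insert z₁ S₁ ∪ insert z₂ S₂)) ⟨?_, ?_⟩
  · rw [card_union_of_disjoint hd, card_union_of_disjoint hd12, hE _ hz₁.1.2.2, hE _ hz₂.1.2.2,
      card_sdiff_of_subset heW] at this
    have := card_le_card heW
    omega
  · exact union_subset (sdiff_subset.trans hW.1) (union_subset
      (insert_subset hz₁.1.1 (hS₁.trans sdiff_subset))
      (insert_subset hz₂.1.1 (hS₂'.trans sdiff_subset)))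
  · exact Tileable.union ⟨_, hM.erase he⟩
      ((Tileable.edge hz₁.1.2.2).union (.edge hz₂.1.2.2) hd12) hd

end TilingBias

/-! ### Absorption and perfect matchings -/

namespace TilingBias

open Finset

variable {α : Type*} [DecidableEq α]
variable {E : Finset (Finset α)} {U X Y S W : Finset α} {M P Q : Finset (Finset α)} {k : ℕ}

lemma card_nbr_add_card_nbr_le (S S' : Finset α) :
    (nbr E U S).card + (nbr E U S').card ≤ (nbr E U S ∩ nbr E U S').card + U.card := by
  rw [← card_union_add_card_inter, add_comm]
  exact Nat.add_le_add_left (card_le_card (union_subset nbr_subset nbr_subset)) _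

/-- The pairs `(z, w)` outside `A` which complete `T` to an edge. -/
def completions (E : Finset (Finset α)) (U A T : Finset α) : Finset (α × α) :=
  ((U \ A) ×ˢ (U \ A)).filter fun p => insert p.2 (insert p.1 T) ∈ E

lemma card_completions_le {A T : Finset α} : (completions E U A T).card ≤ U.card ^ 2 := by
  refine (card_filter_le _ _).trans ?_
  rw [card_product, sq]
  exact Nat.mul_le_mul (card_le_card sdiff_subset) (card_le_card sdiff_subset)

open Classical in
/-- For every `k`-set `L`, a positive proportion of all pairs completes a given `(k-2)`-set `T` to
an edge `e` which absorbs `L`. -/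
lemma card_absorbing_completions {ε : ℝ} (hk : 2 ≤ k)
    (hdeg : ∀ S ⊆ U, S.card = k - 1 → (1 / 2 + ε) * U.card ≤ (nbr E U S).card)
    (hbig : 4 * (k : ℝ) ≤ ε * U.card) {A T L : Finset α}
    (hA : (A.card : ℝ) ≤ ε * U.card / 2) (hT : T ⊆ U \ A) (hTc : T.card = k - 2)
    (hL : L ⊆ U \ A) (hLc : L.card = k) (hTL : Disjoint T L) :
    ε / 2 * (U.card : ℝ) ^ 2 ≤ ((completions E U A T).filter fun p =>
      Disjoint (insert p.2 (insert p.1 T)) L ∧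
        Tileable E (insert p.2 (insert p.1 T) ∪ L)).card := by
  obtain ⟨x, hx⟩ : L.Nonempty := by rw [← card_pos]; omega
  set S := L.erase x with hS
  have hSc : S.card = k - 1 := by rw [card_erase_of_mem hx, hLc]
  have hLS : L = insert x S := (insert_erase hx).symm
  have hTU : T ⊆ U := hT.trans sdiff_subset
  have hLU : L ⊆ U := hL.trans sdiff_subset
  have hxT : x ∉ T := disjoint_right.1 hTL hx
  -- With `L = {x} ∪ S`, the choices are `z` completing `S` and `w` completing both `T ∪ {x}` and `T
  -- ∪ {z}`. Then `T ∪ {z, w}` is an edge, and its union with `L` splits into the edges `S ∪ {z}`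
  -- and `T ∪ {x, w}`. There are at least `n/2` choices of `z` and then `εn` of `w`.
  set Z := nbr E U S \ (A ∪ T ∪ L) with hZ
  set R : α → Finset α := fun z => (nbr E U (insert x T) ∩ nbr E U (insert z T)) \ (A ∪ L) with hR
  have hk' : (T.card : ℝ) ≤ k := by exact_mod_cast (by omega : T.card ≤ k)
  have hZc : (U.card : ℝ) / 2 ≤ Z.card := by
    have h1 : (nbr E U S).card ≤ Z.card + (A.card + T.card + L.card) := by
      refine (card_le_card_sdiff_add_card (s := nbr E U S) (t := A ∪ T ∪ L)).trans ?_
      gcongr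
      exact (card_union_le _ _).trans (by gcongr; exact card_union_le _ _)
    have h2 := hdeg S ((erase_subset _ _).trans hLU) hSc
    have h3 : ((nbr E U S).card : ℝ) ≤ Z.card + (A.card + T.card + L.card) := by exact_mod_cast h1
    rw [hLc] at h3
    linarith
  have hRc : ∀ z ∈ Z, ε * U.card ≤ (R z).card := by
    intro z hz
    simp only [hZ, mem_sdiff, mem_union, not_or, mem_nbr] at hz
    have h1 := card_nbr_add_card_nbr_le (E := E) (U := U) (insert x T) (insert z T)
    have h2 := hdeg (insert x T) (insert_subset (hLU hx) hTU) (by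
      rw [card_insert_of_notMem hxT]; omega)
    have h3 := hdeg (insert z T) (insert_subset hz.1.1 hTU) (by
      rw [card_insert_of_notMem hz.2.1.2]; omega)
    have h4 : (nbr E U (insert x T) ∩ nbr E U (insert z T)).card ≤ (R z).card +
        (A.card + L.card) := by
      refine (card_le_card_sdiff_add_card (t := A ∪ L)).trans ?_
      gcongr
      exact card_union_le _ _
    have h5 : ((nbr E U (insert x T)).card : ℝ) + (nbr E U (insert z T)).card ≤
        (R z).card + (A.card + L.card) + U.card := by exact_mod_cast h1.trans (by gcongr)
    rw [hLc] at h5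
    linarith
  have hsig : (Z.sigma R).card ≤ ((completions E U A T).filter fun p =>
      Disjoint (insert p.2 (insert p.1 T)) L ∧
        Tileable E (insert p.2 (insert p.1 T) ∪ L)).card := by
    refine card_le_card_of_injOn (fun p => (p.1, p.2)) ?_ ?_
    · rintro ⟨z, w⟩ hzw
      simp only [hZ, hR, coe_sigma, Set.mem_sigma_iff, mem_coe, mem_sdiff, mem_union, not_or,
        mem_nbr, mem_inter, mem_insert] at hzw
      obtain ⟨⟨⟨hzU, hzS, hzE⟩, ⟨hzA, hzT⟩, hzL⟩, ⟨⟨hwU, ⟨hwx, hwT⟩, hwE⟩, -, ⟨hwz, -⟩, hwE'⟩,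
        hwA, hwL⟩ := hzw
      simp only [completions, mem_coe, mem_filter, mem_product, mem_sdiff]
      refine ⟨⟨⟨⟨hzU, hzA⟩, hwU, hwA⟩, hwE'⟩, ?_, ?_⟩
      · rw [disjoint_insert_left, disjoint_insert_left]
        exact ⟨hwL, hzL, hTL⟩
      · have : insert w (insert z T) ∪ L = insert z S ∪ insert w (insert x T) := by
          rw [hLS]
          ext v
          simp
          tauto
        rw [this]
        refine (Tileable.edge hzE).union (.edge hwE) ?_
        have hSL : S ⊆ L := erase_subset _ _
        rw [disjoint_insert_left, disjoint_insert_right, disjoint_insert_right, mem_insert,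
          mem_insert, not_or, not_or]
        exact ⟨⟨fun h => hwz h.symm, fun h => hzL (h ▸ hx), hzT⟩, fun h => hwL (hSL h),
          notMem_erase _ _, (hTL.mono_right hSL).symm⟩
    · rintro ⟨z, w⟩ - ⟨z', w'⟩ - h
      simpa using h
  have h6 : (Z.card : ℝ) * (ε * U.card) ≤ ((Z.sigma R).card : ℝ) := by
    rw [card_sigma, Nat.cast_sum, ← nsmul_eq_mul]
    exact card_nsmul_le_sum _ _ _ hRc
  have h7 : 0 ≤ ε * U.card := le_trans (by positivity) hbig
  have h8 : ((Z.sigma R).card : ℝ) ≤ _ := Nat.cast_le.2 hsig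
  nlinarith

open Classical in
/-- Some edge outside `A` meets or absorbs a positive proportion of any given family of
`k`-sets. -/
lemma exists_edge_absorbing_many {ε : ℝ} (hE : ∀ e ∈ E, e.card = k) (hk : 2 ≤ k) (hε : 0 < ε)
    (hε' : ε ≤ 1 / 2)
    (hdeg : ∀ S ⊆ U, S.card = k - 1 → (1 / 2 + ε) * U.card ≤ (nbr E U S).card)
    (hbig : 4 * (k : ℝ) ≤ ε * U.card) {A : Finset α}
    (hA : (A.card : ℝ) ≤ ε * U.card / 2) (𝓛 : Finset (Finset α))
    (h𝓛 : ∀ L ∈ 𝓛, L ⊆ U \ A ∧ L.card = k) :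
    ∃ e ∈ E, e ⊆ U \ A ∧
      ((𝓛.filter fun L => Disjoint e L ∧ ¬ Tileable E (e ∪ L)).card : ℝ) ≤
        (1 - ε / 2) * 𝓛.card := by
  have hUA : 4 * k ≤ (U \ A).card := by
    have h1 := card_le_card_sdiff_add_card (s := U) (t := A)
    have h2 : (U.card : ℝ) ≤ (U \ A).card + A.card := by exact_mod_cast h1
    have h3 : (0 : ℝ) ≤ U.card := by positivity
    have : (4 * k : ℝ) ≤ (U \ A).card := by nlinarith
    exact_mod_cast this
  obtain ⟨T, hT, hTc⟩ := exists_subset_card_eq (s := U \ A) (n := k - 2) (by omega)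
  obtain ⟨L₀, hL₀, hL₀c⟩ := exists_subset_card_eq (s := (U \ A) \ T) (n := k) (by
    rw [card_sdiff_of_subset hT]; omega)
  set C := completions E U A T with hC
  set edge : α × α → Finset α := fun p => insert p.2 (insert p.1 T) with hedge
  have hgood := fun L h1 h2 h3 => card_absorbing_completions (L := L) hk hdeg hbig hA hT hTc
    h1 h2 h3
  have hUpos : 0 < U.card := by
    have := card_le_card (sdiff_subset (s := U) (t := A))
    omega
  have hCpos : C.Nonempty := by
    have h := hgood L₀ (hL₀.trans sdiff_subset) hL₀c (disjoint_sdiff.mono_right hL₀)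
    have h' : (0 : ℝ) < ε / 2 * (U.card : ℝ) ^ 2 := by positivity
    have h'' := h'.trans_le h
    rw [Nat.cast_pos, card_pos] at h''
    exact h''.mono (filter_subset _ _)
  set bad : α × α → Finset α → Prop := fun p L => Disjoint (edge p) L ∧ ¬ Tileable E (edge p ∪ L)
    with hbad
  have hbadle : ∀ L ∈ 𝓛, ((C.filter fun p => bad p L).card : ℝ) ≤ (1 - ε / 2) * C.card := by
    intro L hL
    by_cases hTL : Disjoint T L
    · have h := hgood L (h𝓛 L hL).1 (h𝓛 L hL).2 hTL
      have h2 : (C.filter fun p => bad p L).card + (C.filter fun p =>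
          Disjoint (edge p) L ∧ Tileable E (edge p ∪ L)).card ≤ C.card := by
        rw [← card_union_of_disjoint]
        · exact card_le_card (union_subset (filter_subset _ _) (filter_subset _ _))
        · rw [Finset.disjoint_left]
          intro p hp hp'
          exact (mem_filter.1 hp).2.2 (mem_filter.1 hp').2.2
      have h3 : ((C.filter fun p => bad p L).card : ℝ) + (C.filter fun p =>
          Disjoint (edge p) L ∧ Tileable E (edge p ∪ L)).card ≤ C.card := by exact_mod_cast h2
      have h4 : (C.card : ℝ) ≤ (U.card : ℝ) ^ 2 := by exact_mod_cast card_completions_le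
      nlinarith
    · have : (C.filter fun p => bad p L) = ∅ := by
        rw [filter_eq_empty_iff]
        rintro p - ⟨h, -⟩
        exact hTL (h.mono_left ((subset_insert _ _).trans (subset_insert _ _)))
      rw [this, card_empty, Nat.cast_zero]
      have : (0 : ℝ) ≤ C.card := by positivity
      nlinarith
  -- Double counting of bad incidences: the proportion of bad pairs for each `L` bounds the average
  -- proportion of bad `L` over pairs.
  have hsum : ∑ p ∈ C, ((𝓛.filter fun L => bad p L).card : ℝ) ≤
      ∑ p ∈ C, (1 - ε / 2) * 𝓛.card := by
    have h1 : ∑ p ∈ C, (𝓛.filter fun L => bad p L).card =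
        ∑ L ∈ 𝓛, (C.filter fun p => bad p L).card :=
      sum_card_bipartiteAbove_eq_sum_card_bipartiteBelow bad
    have h2 : ∑ p ∈ C, ((𝓛.filter fun L => bad p L).card : ℝ) =
        ∑ L ∈ 𝓛, ((C.filter fun p => bad p L).card : ℝ) := by exact_mod_cast h1
    rw [h2]
    refine (sum_le_sum hbadle).trans_eq ?_
    rw [sum_const, sum_const, nsmul_eq_mul, nsmul_eq_mul]
    ring
  obtain ⟨p, hp, hple⟩ := exists_le_of_sum_le hCpos hsum
  have hp' := hp
  simp only [hC, completions, mem_filter, mem_product] at hp'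
  exact ⟨edge p, hp'.2, insert_subset hp'.1.2 (insert_subset hp'.1.1 hT), hple⟩

-- Greedy choice of `s` disjoint edges, each cutting the family of not yet absorbed `k`-sets by the
-- factor `1 - ε/2`. Sets meeting the new edge may be ignored, since they no longer lie outside `A`.
open Classical in
lemma exists_partial_absorber {ε : ℝ} (hE : ∀ e ∈ E, e.card = k) (hk : 2 ≤ k) (hε : 0 < ε)
    (hε' : ε ≤ 1 / 2)
    (hdeg : ∀ S ⊆ U, S.card = k - 1 → (1 / 2 + ε) * U.card ≤ (nbr E U S).card)
    (hbig : 4 * (k : ℝ) ≤ ε * U.card) (s : ℕ) (hs : (k * s : ℝ) ≤ ε * U.card / 2) :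
    ∃ (A : Finset α) (F : Finset (Finset α)), A ⊆ U ∧ Tiles E A F ∧ A.card = k * s ∧
      (((powersetCard k (U \ A)).filter fun L => ∀ e ∈ F, ¬ Tileable E (e ∪ L)).card : ℝ) ≤
        (1 - ε / 2) ^ s * (U.card : ℝ) ^ k := by
  induction s with
  | zero =>
    refine ⟨∅, ∅, by simp, .empty, by simp, ?_⟩
    simp only [sdiff_empty, notMem_empty, false_implies, implies_true, filter_true,
      card_powersetCard, pow_zero, one_mul]
    exact_mod_cast Nat.choose_le_pow _ _
  | succ s ih =>
    push_cast at hs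
    have hkpos : (0 : ℝ) ≤ k := by positivity
    obtain ⟨A, F, hAU, hF, hAc, hcard⟩ := ih (by linarith)
    set 𝓛 := (powersetCard k (U \ A)).filter fun L => ∀ e ∈ F, ¬ Tileable E (e ∪ L) with h𝓛
    obtain ⟨e, he, heU, hecard⟩ := exists_edge_absorbing_many hE hk hε hε' hdeg hbig (A := A)
      (by rw [hAc]; push_cast; linarith) 𝓛 (fun L hL => by
        rw [h𝓛, mem_filter, mem_powersetCard] at hL
        exact hL.1)
    have hd : Disjoint A e := disjoint_sdiff.mono_right heU
    refine ⟨A ∪ e, F ∪ {e}, union_subset hAU (heU.trans sdiff_subset),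
      hF.disj_union (.singleton he) hd, ?_, ?_⟩
    · rw [card_union_of_disjoint hd, hAc, hE e he]
      ring
    · have hsub : ((powersetCard k (U \ (A ∪ e))).filter fun L =>
          ∀ f ∈ F ∪ {e}, ¬ Tileable E (f ∪ L)) ⊆
          𝓛.filter fun L => Disjoint e L ∧ ¬ Tileable E (e ∪ L) := by
        intro L hL
        simp only [h𝓛, mem_filter, mem_powersetCard, mem_union, mem_singleton] at hL ⊢
        obtain ⟨⟨h1, h2⟩, h3⟩ := hL
        refine ⟨⟨⟨h1.trans (sdiff_subset_sdiff Subset.rfl subset_union_left), h2⟩,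
          fun f hf => h3 f (.inl hf)⟩, ?_, h3 e (.inr rfl)⟩
        exact disjoint_sdiff.mono subset_union_right h1
      calc _ ≤ (((𝓛.filter fun L => Disjoint e L ∧ ¬ Tileable E (e ∪ L)).card : ℕ) : ℝ) := by
            exact_mod_cast card_le_card hsub
        _ ≤ (1 - ε / 2) * 𝓛.card := hecard
        _ ≤ (1 - ε / 2) * ((1 - ε / 2) ^ s * (U.card : ℝ) ^ k) := by
            gcongr
            linarith
        _ = _ := by ring

/-- Exponential decay beats polynomial growth: linearly many absorbing edges bring the number of
unabsorbed `k`-sets below one, hence to zero. -/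
lemma eventually_pow_mul_pow_div_lt_one {ρ : ℝ} (h0 : 0 < ρ) (h1 : ρ < 1) (k : ℕ) {N : ℕ}
    (hN : 0 < N) : ∃ m₀ : ℕ, ∀ m ≥ m₀, ρ ^ (m / N) * (m : ℝ) ^ k < 1 := by
  have h := (tendsto_pow_const_mul_const_pow_of_lt_one k h0.le h1).const_mul
    ((2 * N : ℝ) ^ k)
  rw [mul_zero] at h
  obtain ⟨s₀, hs₀⟩ := Filter.eventually_atTop.1 (h.eventually_lt_const one_pos)
  refine ⟨N * (s₀ + 1), fun m hm => ?_⟩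
  have hs : s₀ + 1 ≤ m / N := by rwa [Nat.le_div_iff_mul_le hN, mul_comm]
  refine lt_of_le_of_lt ?_ (hs₀ (m / N) (by omega))
  have hmle : m ≤ 2 * N * (m / N) := by
    have h3 := Nat.div_add_mod m N
    have h4 := Nat.mod_lt m hN
    have h5 : N * 1 ≤ N * (m / N) := Nat.mul_le_mul_left _ (by omega)
    linarith
  have hmle' : (m : ℝ) ≤ 2 * N * (m / N : ℕ) := by exact_mod_cast hmle
  calc ρ ^ (m / N) * (m : ℝ) ^ k ≤ ρ ^ (m / N) * (2 * N * (m / N : ℕ)) ^ k := by gcongr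
    _ = _ := by rw [mul_pow]; ring

/-- Codegree at least `(1/2 + ε)n` forces a perfect matching (Rödl, Ruciński and Szemerédi). -/
theorem exists_forall_tileable {k : ℕ} (hk : 2 ≤ k) {ε : ℝ} (hε : 0 < ε) (hε' : ε ≤ 1 / 2) :
    ∃ m₀ : ℕ, ∀ {α : Type*} [DecidableEq α] (E : Finset (Finset α)) (U : Finset α),
      (∀ e ∈ E, e.card = k) → m₀ ≤ U.card → k ∣ U.card →
      (∀ S ⊆ U, S.card = k - 1 → (1 / 2 + ε) * U.card ≤ (nbr E U S).card) → Tileable E U := by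
  classical
  -- Chosen so that `|U| / N` disjoint edges cover at most `ε|U|/2` vertices.
  set N := ⌈2 * k / ε⌉₊ with hN
  have hkpos : (0 : ℝ) < k := by positivity
  have hNpos : 0 < N := Nat.ceil_pos.2 (by positivity)
  obtain ⟨m₀, hm₀⟩ := eventually_pow_mul_pow_div_lt_one (ρ := 1 - ε / 2) (by linarith)
    (by linarith) k hNpos
  refine ⟨max m₀ ⌈4 * k / ε⌉₊, fun {α} _ E U hE hm hdvd hdeg => ?_⟩
  rw [max_le_iff, Nat.ceil_le, div_le_iff₀ hε] at hm
  have hs : (k * (U.card / N : ℕ) : ℝ) ≤ ε * U.card / 2 := by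
    have h1 : 2 * k ≤ N * ε := by
      rw [← div_le_iff₀ hε]
      exact Nat.le_ceil _
    have h2 : ((U.card / N : ℕ) : ℝ) * N ≤ U.card := by exact_mod_cast Nat.div_mul_le_self _ _
    have h3 : (0 : ℝ) ≤ (U.card / N : ℕ) := by positivity
    nlinarith
  obtain ⟨A, F, hAU, hF, hAc, hcard⟩ := exists_partial_absorber hE hk hε hε' hdeg
    (by linarith [hm.2]) (U.card / N) hs
  have habs : ∀ L ⊆ U \ A, L.card = k → Tileable E (A ∪ L) := by
    have h0 := hcard.trans_lt (hm₀ _ hm.1)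
    have h0' : ((powersetCard k (U \ A)).filter fun L => ∀ e ∈ F, ¬ Tileable E (e ∪ L)) = ∅ := by
      rw [← card_eq_zero]
      exact Nat.lt_one_iff.1 (by exact_mod_cast h0)
    intro L hL hLc
    rw [filter_eq_empty_iff] at h0'
    have := h0' (mem_powersetCard.2 ⟨hL, hLc⟩)
    push Not at this
    obtain ⟨e, he, het⟩ := this
    have heA := hF.subset_of_mem he
    have : A ∪ L = (A \ e) ∪ (e ∪ L) := by
      rw [← union_assoc, sdiff_union_of_subset heA]
    rw [this]
    refine Tileable.union ⟨_, hF.erase he⟩ het ?_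
    rw [disjoint_union_right]
    exact ⟨disjoint_sdiff_self_left, (disjoint_sdiff.mono_right hL).mono_left sdiff_subset⟩
  have hAle : (A.card : ℝ) ≤ ε * U.card / 2 := by rw [hAc]; push_cast; exact hs
  have hUA := card_sdiff_add_card_eq_card hAU
  obtain ⟨W, hW, hWt, hWc⟩ := exists_tileable_card_sdiff_lt (U := U \ A) hE hk (by
    intro S hS hSc
    have h1 := hdeg S (hS.trans sdiff_subset) hSc
    have h2 := card_nbr_le_add (E := E) (U := U) (S := S) (W := A)
    have h2' : ((nbr E U S).card : ℝ) ≤ (nbr E (U \ A) S).card + A.card := by exact_mod_cast h2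
    have h3 : ((U \ A).card : ℝ) ≤ U.card := by exact_mod_cast card_le_card sdiff_subset
    have h5 : 0 ≤ ε * U.card := by positivity
    have h4 : ((U \ A).card : ℝ) ≤ 2 * (nbr E (U \ A) S).card := by linarith
    exact_mod_cast h4)
  have hdW : Disjoint A W := disjoint_sdiff.mono_right hW
  have hcW := card_sdiff_add_card_eq_card hW
  obtain ⟨M, hM⟩ := hWt
  have hdvd' : k ∣ ((U \ A) \ W).card := by
    have h1 := hM.card hE
    have h2 := hF.card hE
    have : ((U \ A) \ W).card = U.card - A.card - W.card := by omega
    rw [this, h1, h2]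
    exact Nat.dvd_sub (Nat.dvd_sub hdvd (Dvd.intro _ rfl)) (Dvd.intro _ rfl)
  obtain ⟨q, hq⟩ := hdvd'
  -- The leftover has fewer than `2(k-1)` vertices and size divisible by `k`, so it is empty or a
  -- single `k`-set.
  have hq2 : q < 2 := by
    by_contra! h
    have := Nat.mul_le_mul_left k h
    omega
  have hUeq : U = (A ∪ ((U \ A) \ W)) ∪ W := by
    rw [union_assoc, sdiff_union_of_subset hW, union_sdiff_of_subset hAU]
  rw [hUeq]
  refine Tileable.union ?_ ⟨M, hM⟩ (disjoint_union_left.2 ⟨hdW, disjoint_sdiff_self_left⟩)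
  interval_cases q
  · rw [mul_zero, card_eq_zero] at hq
    rw [hq, union_empty]
    exact ⟨F, hF⟩
  · exact habs _ sdiff_subset (by omega)

end TilingBias

/-! ### Balanced weights and vertex potentials -/

namespace TilingBias

open Finset

variable {α : Type*} [DecidableEq α]
variable {E : Finset (Finset α)} {U X Y S W : Finset α} {M P Q : Finset (Finset α)} {k : ℕ}

lemma Tiles.sum_union {f : Finset α → ℤ} (hE : ∀ e ∈ E, e.card = k) (hk : 0 < k)
    (hP : Tiles E X P) (hQ : Tiles E Y Q) (hXY : Disjoint X Y) :
    ∑ e ∈ P ∪ Q, f e = ∑ e ∈ P, f e + ∑ e ∈ Q, f e :=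
  Finset.sum_union (hP.disjoint_tiles hE hk hQ hXY)

/-- Any two tilings of a set of at most `3k` vertices of `U` have the same total weight. -/
def Balanced (E : Finset (Finset α)) (U : Finset α) (k : ℕ) (f : Finset α → ℤ) : Prop :=
  ∀ X ⊆ U, X.card ≤ 3 * k → ∀ P Q, Tiles E X P → Tiles E X Q → ∑ e ∈ P, f e = ∑ e ∈ Q, f e

variable {f : Finset α → ℤ}

lemma notMem_of_insert_mem (hE : ∀ e ∈ E, e.card = k) (hk : 0 < k) (hS : S.card = k - 1) {x : α}
    (h : insert x S ∈ E) : x ∉ S := by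
  intro hx
  have := hE _ h
  rw [insert_eq_of_mem hx] at this
  omega

lemma Balanced.pair (hE : ∀ e ∈ E, e.card = k) (hk : 0 < k) (hf : Balanced E U k f)
    {a b a' b' : Finset α} (ha : a ∈ E) (hb : b ∈ E) (ha' : a' ∈ E) (hb' : b' ∈ E)
    (hab : Disjoint a b) (hab' : Disjoint a' b') (hU : a ∪ b ⊆ U) (h : a ∪ b = a' ∪ b') :
    f a + f b = f a' + f b' := by
  have h1 := hf (a ∪ b) hU (by rw [card_union_of_disjoint hab, hE a ha, hE b hb]; omega) _ _
    ((Tiles.singleton ha).disj_union (.singleton hb) hab)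
    (h ▸ (Tiles.singleton ha').disj_union (.singleton hb') hab')
  rwa [Tiles.sum_union hE hk (.singleton ha) (.singleton hb) hab,
    Tiles.sum_union hE hk (.singleton ha') (.singleton hb') hab', sum_singleton, sum_singleton,
    sum_singleton, sum_singleton] at h1

lemma Balanced.triple (hE : ∀ e ∈ E, e.card = k) (hk : 0 < k) (hf : Balanced E U k f)
    {a b c a' b' c' : Finset α} (ha : a ∈ E) (hb : b ∈ E) (hc : c ∈ E) (ha' : a' ∈ E)
    (hb' : b' ∈ E) (hc' : c' ∈ E) (hab : Disjoint a b) (habc : Disjoint (a ∪ b) c)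
    (hab' : Disjoint a' b') (habc' : Disjoint (a' ∪ b') c')
    (hU : a ∪ b ∪ c ⊆ U) (h : a ∪ b ∪ c = a' ∪ b' ∪ c') :
    f a + f b + f c = f a' + f b' + f c' := by
  have t := (Tiles.singleton ha).disj_union (.singleton hb) hab
  have t' := (Tiles.singleton ha').disj_union (.singleton hb') hab'
  have h1 := hf (a ∪ b ∪ c) hU (by
      rw [card_union_of_disjoint habc, card_union_of_disjoint hab, hE a ha, hE b hb, hE c hc]
      omega) _ _
    (t.disj_union (.singleton hc) habc) (h ▸ t'.disj_union (.singleton hc') habc')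
  rwa [Tiles.sum_union hE hk t (.singleton hc) habc,
    Tiles.sum_union hE hk t' (.singleton hc') habc',
    Tiles.sum_union hE hk (.singleton ha) (.singleton hb) hab,
    Tiles.sum_union hE hk (.singleton ha') (.singleton hb') hab', sum_singleton, sum_singleton,
    sum_singleton, sum_singleton, sum_singleton, sum_singleton] at h1

/-- All `(k-1)`-sets have degree at least `|U|/2 + 2k`. -/
def LargeCodegree (E : Finset (Finset α)) (U : Finset α) (k : ℕ) : Prop :=
  ∀ S ⊆ U, S.card = k - 1 → U.card + 4 * k ≤ 2 * (nbr E U S).card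

lemma LargeCodegree.exists_common (hd : LargeCodegree E U k) {S S' : Finset α} (hS : S ⊆ U)
    (hSc : S.card = k - 1) (hS' : S' ⊆ U) (hSc' : S'.card = k - 1) (X : Finset α)
    (hX : X.card < 4 * k) :
    ∃ z ∈ U, z ∉ X ∧ z ∉ S ∧ z ∉ S' ∧ insert z S ∈ E ∧ insert z S' ∈ E := by
  have h1 := hd S hS hSc
  have h2 := hd S' hS' hSc'
  have h3 := card_nbr_add_card_nbr_le (E := E) (U := U) S S'
  obtain ⟨z, hz, hzX⟩ := exists_mem_notMem_of_card_lt_card (s := X)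
    (t := nbr E U S ∩ nbr E U S') (by omega)
  simp only [mem_inter, mem_nbr] at hz
  exact ⟨z, hz.1.1, hzX, hz.1.2.1, hz.2.2.1, hz.1.2.2, hz.2.2.2⟩

/-- Take any `k - 2` vertices `T` outside `X` and a common neighbour of `T ∪ {x}` and `T ∪ {y}`.
This supplies a place, away from everything in use, where `x` and `y` can be exchanged. -/
lemma LargeCodegree.exists_link (hd : LargeCodegree E U k) (hk : 2 ≤ k) (hU : 4 * k ≤ U.card)
    {x y : α} (hx : x ∈ U) (hy : y ∈ U) (X : Finset α) (hxX : x ∈ X) (hyX : y ∈ X)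
    (hX : X.card ≤ 3 * k) :
    ∃ S ⊆ U, S.card = k - 1 ∧ Disjoint S X ∧ insert x S ∈ E ∧ insert y S ∈ E := by
  have h1 := le_card_sdiff X U
  obtain ⟨T, hT, hTc⟩ := exists_subset_card_eq (s := U \ X) (n := k - 2) (by omega)
  have hTX : ∀ v ∈ X, v ∉ T := fun v hv hvT => (mem_sdiff.1 (hT hvT)).2 hv
  have hTU : T ⊆ U := hT.trans sdiff_subset
  obtain ⟨z, hzU, hzX, hz1, hz2, hz3, hz4⟩ := hd.exists_common (insert_subset hx hTU)
    (by rw [card_insert_of_notMem (hTX x hxX)]; omega) (insert_subset hy hTU)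
    (by rw [card_insert_of_notMem (hTX y hyX)]; omega) X (by omega)
  rw [mem_insert, not_or] at hz1
  refine ⟨insert z T, insert_subset hzU hTU, ?_, ?_, ?_, ?_⟩
  · rw [card_insert_of_notMem hz1.2]
    omega
  · rw [disjoint_insert_left]
    exact ⟨hzX, disjoint_sdiff_self_left.mono_left hT⟩
  · rwa [insert_comm]
  · rwa [insert_comm]

/-- The pairs `S ∪ {x}, S' ∪ {y}` and `S ∪ {y}, S' ∪ {x}` tile the same set. -/
lemma Balanced.swap_eq_of_disjoint (hE : ∀ e ∈ E, e.card = k) (hk : 0 < k) (hf : Balanced E U k f)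
    {S S' : Finset α} {x y : α} (hS : S ⊆ U) (hS' : S' ⊆ U) (hSc : S.card = k - 1)
    (hSc' : S'.card = k - 1) (hSS' : Disjoint S S')
    (h1 : insert x S ∈ E) (h2 : insert y S ∈ E) (h3 : insert x S' ∈ E) (h4 : insert y S' ∈ E)
    (hx : x ∈ U) (hy : y ∈ U) :
    f (insert x S) - f (insert y S) = f (insert x S') - f (insert y S') := by
  rcases eq_or_ne x y with rfl | hxy
  · simp
  have n1 := notMem_of_insert_mem hE hk hSc h1
  have n2 := notMem_of_insert_mem hE hk hSc h2
  have n3 := notMem_of_insert_mem hE hk hSc' h3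
  have n4 := notMem_of_insert_mem hE hk hSc' h4
  have := hf.pair hE hk h1 h4 h2 h3 (by
      simp only [disjoint_insert_left, disjoint_insert_right, mem_insert]; tauto) (by
      simp only [disjoint_insert_left, disjoint_insert_right, mem_insert]; tauto)
      (by simp only [union_subset_iff, insert_subset_iff]; tauto)
      (by ext v; simp only [mem_union, mem_insert]; tauto)
  linarith

/-- Both sides are compared with a third link `R` disjoint from `S` and `S'`. -/
lemma Balanced.swap_eq (hE : ∀ e ∈ E, e.card = k) (hk : 2 ≤ k) (hf : Balanced E U k f)
    (hd : LargeCodegree E U k) (hU : 4 * k ≤ U.card)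
    {S S' : Finset α} {x y : α} (hS : S ⊆ U) (hS' : S' ⊆ U) (hSc : S.card = k - 1)
    (hSc' : S'.card = k - 1)
    (h1 : insert x S ∈ E) (h2 : insert y S ∈ E) (h3 : insert x S' ∈ E) (h4 : insert y S' ∈ E)
    (hx : x ∈ U) (hy : y ∈ U) :
    f (insert x S) - f (insert y S) = f (insert x S') - f (insert y S') := by
  obtain ⟨R, hR, hRc, hRd, h5, h6⟩ := hd.exists_link hk hU hx hy (insert x (insert y (S ∪ S')))
    (by simp) (by simp) (by
      have := card_union_le S S'
      have := card_insert_le y (S ∪ S')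
      have := card_insert_le x (insert y (S ∪ S'))
      omega)
  simp only [disjoint_insert_right, disjoint_union_right] at hRd
  have hk' : 0 < k := by omega
  rw [hf.swap_eq_of_disjoint hE hk' hS hR hSc hRc hRd.2.2.1.symm h1 h2 h5 h6 hx hy,
    hf.swap_eq_of_disjoint hE hk' hS' hR hSc' hRc hRd.2.2.2.symm h3 h4 h5 h6 hx hy]

/-- Additivity of exchange costs along `x`, `o`, `y`. Two tilings by three edges are compared, which
is why `Balanced` allows `3k` vertices. -/
lemma Balanced.cycle_eq (hE : ∀ e ∈ E, e.card = k) (hk : 0 < k) (hf : Balanced E U k f)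
    {x y o : α} {R A B : Finset α} (hx : x ∈ U) (hy : y ∈ U) (ho : o ∈ U) (hxy : x ≠ y)
    (hyo : y ≠ o) (hxo : x ≠ o) (hR : R ⊆ U) (hA : A ⊆ U) (hB : B ⊆ U)
    (hRA : Disjoint R A) (hRB : Disjoint R B) (hAB : Disjoint A B)
    (hxR : x ∉ R) (hyR : y ∉ R) (hoR : o ∉ R) (hxA : x ∉ A) (hyA : y ∉ A) (hoA : o ∉ A)
    (hxB : x ∉ B) (hyB : y ∉ B) (hoB : o ∉ B)
    (h1 : insert x R ∈ E) (h2 : insert y R ∈ E) (h3 : insert x A ∈ E) (h4 : insert o A ∈ E)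
    (h5 : insert y B ∈ E) (h6 : insert o B ∈ E) :
    f (insert x R) + f (insert o A) + f (insert y B) =
      f (insert y R) + f (insert x A) + f (insert o B) := by
  refine hf.triple hE hk h1 h4 h5 h2 h3 h6 ?_ ?_ ?_ ?_ ?_ ?_
  · simp [hRA, hxA, hoR, hxo.symm]
  · simp [hRB, hAB, hyR, hyA, hxB, hoB, hxy.symm, hyo]
  · simp [hRA, hyA, hxR, hxy]
  · simp [hRB, hAB, hyB, hxB, hoR, hoA, hyo.symm, hxo.symm]
  · simp only [union_subset_iff, insert_subset_iff]
    exact ⟨⟨⟨hx, hR⟩, ho, hA⟩, hy, hB⟩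
  · ext v
    simp only [mem_union, mem_insert]
    tauto

/-- In a balanced hypergraph, exchanging one vertex of an edge changes the weight by a difference
of vertex potentials. -/
lemma Balanced.exists_potential (hE : ∀ e ∈ E, e.card = k) (hk : 2 ≤ k) (hf : Balanced E U k f)
    (hd : LargeCodegree E U k) (hU : 4 * k ≤ U.card) :
    ∃ g : α → ℤ, ∀ x ∈ U, ∀ y ∈ U, ∀ S ⊆ U, S.card = k - 1 → insert x S ∈ E → insert y S ∈ E →
      f (insert x S) - f (insert y S) = g x - g y := by
  obtain ⟨o, ho⟩ : U.Nonempty := by rw [← card_pos]; omega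
  have hk' : 0 < k := by omega
  -- The potential of `x` is the cost of exchanging `x` for a fixed root `o`, which does not depend
  -- on the link.
  have hg : ∀ x, ∃ a : ℤ, x ∈ U → ∀ S ⊆ U, S.card = k - 1 → insert x S ∈ E → insert o S ∈ E →
      f (insert x S) - f (insert o S) = a := by
    intro x
    by_cases hx : x ∈ U
    · obtain ⟨R, hR, hRc, -, h5, h6⟩ := hd.exists_link hk hU hx ho {x, o} (by simp) (by simp)
        (card_le_two.trans (by omega))
      exact ⟨_, fun _ S hS hSc h1 h2 => hf.swap_eq hE hk hd hU hS hR hSc hRc h1 h2 h5 h6 hx ho⟩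
    · exact ⟨0, fun h => absurd h hx⟩
  choose g hg using hg
  have hgo : g o = 0 := by
    obtain ⟨R, hR, hRc, -, h5, -⟩ := hd.exists_link hk hU ho ho {o} (by simp) (by simp)
        (by rw [card_singleton]; omega)
    rw [← hg o ho R hR hRc h5 h5, sub_self]
  refine ⟨g, fun x hx y hy S hS hSc h1 h2 => ?_⟩
  rcases eq_or_ne x y with rfl | hxy
  · simp
  rcases eq_or_ne y o with rfl | hyo
  · rw [hg x hx S hS hSc h1 h2, hgo, sub_zero]
  rcases eq_or_ne x o with rfl | hxo
  · rw [← neg_sub, hg y hy S hS hSc h2 h1, hgo, zero_sub]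
  obtain ⟨A, hA, hAc, hAd, h3, h4⟩ := hd.exists_link hk hU hx ho
    {x, y, o} (by simp) (by simp) (card_le_three.trans (by omega))
  obtain ⟨B, hB, hBc, hBd, h5, h6⟩ := hd.exists_link hk hU hy ho
    (insert x (insert y (insert o A))) (by simp) (by simp) (by
      have := card_insert_le o A
      have := card_insert_le y (insert o A)
      have := card_insert_le x (insert y (insert o A))
      omega)
  simp only [disjoint_insert_right, disjoint_singleton_right] at hAd hBd
  rw [← hg x hx A hA hAc h3 h4, ← hg y hy B hB hBc h5 h6]
  obtain ⟨R, hR, hRc, hRd, h7, h8⟩ := hd.exists_link hk hU hx hy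
    (insert x (insert y (insert o (A ∪ B)))) (by simp) (by simp) (by
      have := card_union_le A B
      have := card_insert_le o (A ∪ B)
      have := card_insert_le y (insert o (A ∪ B))
      have := card_insert_le x (insert y (insert o (A ∪ B)))
      omega)
  simp only [disjoint_insert_right, disjoint_union_right] at hRd
  rw [hf.swap_eq hE hk hd hU hS hR hSc hRc h1 h2 h7 h8 hx hy]
  have := hf.cycle_eq hE hk' hx hy ho hxy hyo hxo hR hA hB hRd.2.2.2.1 hRd.2.2.2.2 hBd.2.2.2.symm
    hRd.1 hRd.2.1 hRd.2.2.1 hAd.1 hAd.2.1 hAd.2.2 hBd.1 hBd.2.1 hBd.2.2.1 h7 h8 h3 h4 h5 h6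
  linarith

/-- A weight which behaves like a sum of potentials under exchanging single vertices is, up to a
constant, the sum of the potentials. -/
lemma LargeCodegree.sub_sum_eq {f : Finset α → ℤ} {g : α → ℤ} (hE : ∀ e ∈ E, e.card = k)
    (hk : 0 < k) (hd : LargeCodegree E U k)
    (hg : ∀ x ∈ U, ∀ y ∈ U, ∀ S ⊆ U, S.card = k - 1 → insert x S ∈ E → insert y S ∈ E →
      f (insert x S) - f (insert y S) = g x - g y)
    {e e' : Finset α} (he : e ∈ E) (heU : e ⊆ U) (he' : e' ∈ E) (heU' : e' ⊆ U) :
    f e - ∑ v ∈ e, g v = f e' - ∑ v ∈ e', g v := by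
  have hswap : ∀ x ∈ U, ∀ y ∈ U, ∀ S ⊆ U, S.card = k - 1 → insert x S ∈ E → insert y S ∈ E →
      f (insert x S) - ∑ v ∈ insert x S, g v = f (insert y S) - ∑ v ∈ insert y S, g v := by
    intro x hx y hy S hS hSc h1 h2
    rw [sum_insert (notMem_of_insert_mem hE hk hSc h1),
      sum_insert (notMem_of_insert_mem hE hk hSc h2)]
    linarith [hg x hx y hy S hS hSc h1 h2]
  have main : ∀ j : ℕ, ∀ S ⊆ U, ∀ S' ⊆ U, S.card = k - 1 → S'.card = k - 1 → (S \ S').card = j →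
      ∀ x ∈ U, ∀ y ∈ U, insert x S ∈ E → insert y S' ∈ E →
      f (insert x S) - ∑ v ∈ insert x S, g v = f (insert y S') - ∑ v ∈ insert y S', g v := by
    intro j
    induction j with
    | zero =>
      intro S hS S' hS' hSc hSc' hj x hx y hy h1 h2
      have : S = S' := eq_of_subset_of_card_le (sdiff_eq_empty_iff_subset.1 (card_eq_zero.1 hj))
        (by omega)
      subst this
      exact hswap x hx y hy S hS hSc h1 h2
    | succ j ih =>
      intro S hS S' hS' hSc hSc' hj x hx y hy h1 h2
      obtain ⟨s, hs⟩ : (S \ S').Nonempty := by rw [← card_pos]; omega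
      obtain ⟨t, ht⟩ : (S' \ S).Nonempty := by
        rw [← card_pos, ← card_sdiff_comm (hSc.trans hSc'.symm)]; omega
      rw [mem_sdiff] at hs ht
      have htR : t ∉ S.erase s := fun h => ht.2 (mem_of_mem_erase h)
      have hRc : (S.erase s).card = k - 1 - 1 := by rw [card_erase_of_mem hs.1, hSc]
      have hSpos : 0 < S.card := card_pos.2 ⟨s, hs.1⟩
      have hRU : S.erase s ⊆ U := (erase_subset _ _).trans hS
      have hS''U : insert t (S.erase s) ⊆ U := insert_subset (hS' ht.1) hRU
      have hS''c : (insert t (S.erase s)).card = k - 1 := by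
        rw [card_insert_of_notMem htR]; omega
      have hS''j : (insert t (S.erase s) \ S').card = j := by
        have : insert t (S.erase s) \ S' = (S \ S').erase s := by
          ext v
          simp only [mem_sdiff, mem_insert, mem_erase]
          constructor
          · rintro ⟨rfl | h, h'⟩
            · exact absurd ht.1 h'
            · exact ⟨h.1, h.2, h'⟩
          · rintro ⟨h, h', h''⟩
            exact ⟨.inr ⟨h, h'⟩, h''⟩
        rw [this, card_erase_of_mem (mem_sdiff.2 hs)]
        omega
      -- Replacing `s` by `t` brings `S` closer to `S'`. A common neighbour `z` of the old and new
      -- sets makes this one more single-vertex exchange, of `s` for `t` over `z` and `S \ {s}`.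
      obtain ⟨z, hzU, -, hzS, hzS'', h3, h4⟩ := hd.exists_common hS hSc hS''U hS''c ∅
        (by rw [card_empty]; omega)
      rw [hswap x hx z hzU S hS hSc h1 h3,
        ← ih _ hS''U S' hS' hS''c hSc' hS''j z hzU y hy h4 h2]
      have hzR : z ∉ S.erase s := fun h => hzS (mem_of_mem_erase h)
      have e1 : insert z S = insert s (insert z (S.erase s)) := by
        rw [insert_comm, insert_erase hs.1]
      rw [insert_comm z t] at h4 ⊢
      rw [e1] at h3 ⊢
      exact hswap s (hS hs.1) t (hS' ht.1) _ (insert_subset hzU hRU)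
        (by rw [card_insert_of_notMem hzR]; omega) h3 h4
  obtain ⟨x, hx⟩ : e.Nonempty := by rw [← card_pos, hE e he]; exact hk
  obtain ⟨y, hy⟩ : e'.Nonempty := by rw [← card_pos, hE e' he']; exact hk
  have := main _ (e.erase x) ((erase_subset _ _).trans heU) (e'.erase y)
    ((erase_subset _ _).trans heU') (by rw [card_erase_of_mem hx, hE e he])
    (by rw [card_erase_of_mem hy, hE e' he']) rfl x (heU hx) y (heU' hy)
  rw [insert_erase hx, insert_erase hy] at this
  exact this he he'

/-- In a balanced hypergraph of uniformity at least `3` and large codegree, a 0/1-valued weight is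
constant on the edges avoiding some vertex. -/
theorem Balanced.exists_const (hE : ∀ e ∈ E, e.card = k) (hk : 3 ≤ k) (hf : Balanced E U k f)
    (hd : LargeCodegree E U k) (hU : 4 * k ≤ U.card) (h01 : ∀ e, 0 ≤ f e ∧ f e ≤ 1) :
    ∃ b, ∀ e ∈ E, ∀ e' ∈ E, e ⊆ U → e' ⊆ U → b ∉ e → b ∉ e' → f e = f e' := by
  obtain ⟨g, hg⟩ := hf.exists_potential hE (by omega) hd hU
  have hsum := fun e he heU e' he' heU' =>
    hd.sub_sum_eq (e := e) (e' := e') hE (by omega) hg he heU he' heU'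
  -- Otherwise two edges that differ only by `x, x'` against `y, y'` have weights differing by at
  -- least 2. The `k - 3` vertices of `T` and the common neighbour `z` complete both edges; here `k
  -- ≥ 3` is needed.
  have hstar : ∀ x ∈ U, ∀ y ∈ U, ∀ x' ∈ U, ∀ y' ∈ U, x ≠ x' → y ≠ y' → g y < g x →
      ¬ g y' < g x' := by
    intro x hx y hy x' hx' y' hy' hxx hyy h1 h2
    have hk4 : k - 3 ≤ (U \ {x, y, x', y'}).card := by
      have := le_card_sdiff {x, y, x', y'} U
      have := card_le_four (a := x) (b := y) (c := x') (d := y')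
      omega
    obtain ⟨T, hT, hTc⟩ := exists_subset_card_eq hk4
    have hTU : T ⊆ U := hT.trans sdiff_subset
    have hTn : ∀ v ∈ T, v ≠ x ∧ v ≠ y ∧ v ≠ x' ∧ v ≠ y' := fun v hv => by
      simpa using (mem_sdiff.1 (hT hv)).2
    have m1 : x' ∉ T := fun h => (hTn _ h).2.2.1 rfl
    have m2 : y' ∉ T := fun h => (hTn _ h).2.2.2 rfl
    have m3 : x ∉ insert x' T := by
      rw [mem_insert, not_or]
      exact ⟨hxx, fun h => (hTn _ h).1 rfl⟩
    have m4 : y ∉ insert y' T := by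
      rw [mem_insert, not_or]
      exact ⟨hyy, fun h => (hTn _ h).2.1 rfl⟩
    have s1 : insert x (insert x' T) ⊆ U := insert_subset hx (insert_subset hx' hTU)
    have s2 : insert y (insert y' T) ⊆ U := insert_subset hy (insert_subset hy' hTU)
    obtain ⟨z, hzU, -, hz1, hz2, h3, h4⟩ := hd.exists_common s1
      (by rw [card_insert_of_notMem m3, card_insert_of_notMem m1]; omega) s2
      (by rw [card_insert_of_notMem m4, card_insert_of_notMem m2]; omega) ∅
      (by rw [card_empty]; omega)
    have h5 := hsum _ h3 (insert_subset hzU s1) _ h4 (insert_subset hzU s2)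
    rw [sum_insert hz1, sum_insert hz2, sum_insert m3, sum_insert m4, sum_insert m1,
      sum_insert m2] at h5
    have h6 := h01 (insert z (insert x (insert x' T)))
    have h7 := h01 (insert z (insert y (insert y' T)))
    omega
  have hpair : ∀ x ∈ U, ∀ y ∈ U, ∀ x' ∈ U, ∀ y' ∈ U, x ≠ x' → x ≠ y' → y ≠ x' → y ≠ y' →
      g x ≠ g y → g x' = g y' := by
    intro x hx y hy x' hx' y' hy' n1 n2 n3 n4 h
    by_contra h'
    rcases lt_or_gt_of_ne h with h | h <;> rcases lt_or_gt_of_ne h' with h' | h'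
    · exact hstar y hy x hx y' hy' x' hx' n4 n1 h h'
    · exact hstar y hy x hx x' hx' y' hy' n3 n2 h h'
    · exact hstar x hx y hy y' hy' x' hx' n2 n3 h h'
    · exact hstar x hx y hy x' hx' y' hy' n1 n4 h h'
  suffices ∃ b, ∃ γ, ∀ v ∈ U, v ≠ b → g v = γ by
    obtain ⟨b, γ, hb⟩ := this
    refine ⟨b, fun e he e' he' heU heU' hbe hbe' => ?_⟩
    have hs : ∀ e ∈ E, e ⊆ U → b ∉ e → ∑ v ∈ e, g v = k * γ := by
      intro e he heU hbe
      rw [sum_congr rfl fun v hv => hb v (heU hv) (fun h => hbe (h ▸ hv)), sum_const, hE e he,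
        nsmul_eq_mul]
    have := hsum e he heU e' he' heU'
    rw [hs e he heU hbe, hs e' he' heU' hbe'] at this
    linarith
  by_cases hconst : ∃ x ∈ U, ∃ y ∈ U, g x ≠ g y
  · obtain ⟨x, hx, y, hy, hxy⟩ := hconst
    have hfind : ∀ X : Finset α, X.card ≤ 3 → ∃ z ∈ U, z ∉ X := fun X hX =>
      exists_mem_notMem_of_card_lt_card (by omega)
    obtain ⟨z, hz, hzn⟩ := hfind {x, y} (card_le_two.trans (by omega))
    simp only [mem_insert, mem_singleton, not_or] at hzn
    have hrest : ∀ v ∈ U, v ≠ x → v ≠ y → g v = g z := fun v hv hvx hvy =>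
      hpair x hx y hy v hv z hz hvx.symm (Ne.symm hzn.1) hvy.symm (Ne.symm hzn.2) hxy
    by_cases hxz : g x = g z
    · refine ⟨y, g z, fun v hv hvy => ?_⟩
      by_cases hvx : v = x
      · rw [hvx, hxz]
      · exact hrest v hv hvx hvy
    -- Now `g x ≠ g z`, so `x` is the exceptional vertex: applying `hpair` to `x, z` gives `y` the
    -- value of a fourth vertex `w`, which is already that of `z`.
    · refine ⟨x, g z, fun v hv hvx => ?_⟩
      by_cases hvy : v = y
      · obtain ⟨w, hw, hwn⟩ := hfind {x, y, z} card_le_three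
        simp only [mem_insert, mem_singleton, not_or] at hwn
        rw [hvy, hpair x hx z hz y hy w hw (fun h => hxy (h ▸ rfl)) (Ne.symm hwn.1) hzn.2
          (Ne.symm hwn.2.2) hxz]
        exact hrest w hw hwn.1 hwn.2.1
      · exact hrest v hv hvx hvy
  · push Not at hconst
    obtain ⟨o, ho⟩ : U.Nonempty := by rw [← card_pos]; omega
    exact ⟨o, g o, fun v hv _ => hconst v hv o ho⟩

end TilingBias

/-! ### Colour shifts and biased tilings -/

namespace TilingBias

open Finset

section Count

variable {α : Type*} {r : ℕ}

/-- The number of members of `M` with colour `i`. -/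
def count (c : Finset α → Fin r) (M : Finset (Finset α)) (i : Fin r) : ℕ :=
  (M.filter fun e => c e = i).card

lemma sum_ite_eq_count (c : Finset α → Fin r) (M : Finset (Finset α)) (i : Fin r) :
    ∑ e ∈ M, (if c e = i then (1 : ℤ) else 0) = count c M i := by
  rw [count, card_filter]
  push_cast
  rfl

lemma sum_count (c : Finset α → Fin r) (M : Finset (Finset α)) : ∑ i, count c M i = M.card :=
  (card_eq_sum_card_fiberwise fun _ _ => mem_coe.2 (mem_univ _)).symm

/-- If some colour occurs at least `t` times more often in `M'` than in `M`, then a colour class of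
`M` or `M'` has size at least `(|M| + t) / r`. -/
lemma exists_le_count_of_shift {c : Finset α → Fin r} {M M' : Finset (Finset α)} {i : Fin r}
    {t : ℕ} {x : ℝ} (ht : count c M i + t ≤ count c M' i) (hx : r * x ≤ M.card + t) :
    (∃ j, x ≤ count c M j) ∨ ∃ j, x ≤ count c M' j := by
  by_contra! h
  -- If every class of both were below `x`, the class of `i` in `M` would even be below `x - t`;
  -- summing over colours contradicts `hx`.
  have h1 : ∑ j, ((count c M j : ℝ) + if j = i then (t : ℝ) else 0) < ∑ _j : Fin r, x := by
    refine sum_lt_sum_of_nonempty ⟨i, mem_univ _⟩ fun j _ => ?_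
    split_ifs with hj
    · subst hj
      refine lt_of_le_of_lt ?_ (h.2 j)
      exact_mod_cast ht
    · rw [add_zero]
      exact h.1 j
  rw [sum_add_distrib, ← Nat.cast_sum, sum_count] at h1
  simp only [sum_ite_eq', mem_univ, if_true, sum_const, card_univ, Fintype.card_fin,
    nsmul_eq_mul] at h1
  linarith

end Count

variable {α : Type*} [DecidableEq α]
variable {E : Finset (Finset α)} {U X Y S W : Finset α} {M P Q : Finset (Finset α)} {k r : ℕ}
variable {f : Finset α → ℤ}

lemma Balanced.mono (hf : Balanced E U k f) (h : W ⊆ U) : Balanced E W k f :=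
  fun X hX => hf X (hX.trans h)

/-- Either there is a small set with two tilings whose weights differ by at least `t`, or all of
`U` except for a small set is balanced. -/
lemma exists_shift_or_balanced (hE : ∀ e ∈ E, e.card = k) (hk : 0 < k) (U : Finset α)
    (f : Finset α → ℤ) (t : ℕ) :
    (∃ W ⊆ U, W.card ≤ 3 * k * t ∧ ∃ P Q, Tiles E W P ∧ Tiles E W Q ∧
      ∑ e ∈ P, f e + t ≤ ∑ e ∈ Q, f e) ∨
    ∃ W ⊆ U, W.card ≤ 3 * k * t ∧ Balanced E (U \ W) k f := by
  induction t with
  | zero => exact .inl ⟨∅, by simp, by simp, ∅, ∅, .empty, .empty, by simp⟩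
  | succ t ih =>
    rcases ih with ⟨W, hWU, hWc, P, Q, hP, hQ, hPQ⟩ | ⟨W, hWU, hWc, hW⟩
    · by_cases hb : Balanced E (U \ W) k f
      · exact .inr ⟨W, hWU, hWc.trans (by gcongr; omega), hb⟩
      · left
        simp only [Balanced] at hb
        push Not at hb
        obtain ⟨X, hX, hXc, P', Q', hP', hQ', hne⟩ := hb
        have hd : Disjoint W X := disjoint_sdiff.mono_right hX
        have hc : (W ∪ X).card ≤ 3 * k * (t + 1) := by
          rw [card_union_of_disjoint hd]
          linarith
        have hU : W ∪ X ⊆ U := union_subset hWU (hX.trans sdiff_subset)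
        -- The weights are integers, so the new gadget adds at least 1 once its lighter tiling is
        -- joined to `P` and its heavier one to `Q`.
        rcases lt_or_gt_of_ne hne with h | h
        · refine ⟨_, hU, hc, _, _, hP.disj_union hP' hd, hQ.disj_union hQ' hd, ?_⟩
          rw [hP.sum_union hE hk hP' hd, hQ.sum_union hE hk hQ' hd]
          push_cast
          omega
        · refine ⟨_, hU, hc, _, _, hP.disj_union hQ' hd, hQ.disj_union hP' hd, ?_⟩
          rw [hP.sum_union hE hk hQ' hd, hQ.sum_union hE hk hP' hd]
          push_cast
          omega
    · exact .inr ⟨W, hWU, hWc.trans (by gcongr; omega), hW⟩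

/-- If the edges avoiding a set `W` are monochromatic, then so are all but at most `|W|` edges of
a tiling. -/
lemma exists_card_le_count_add {c : Finset α → Fin r} (hr : 0 < r) (hM : Tiles E U M)
    (hmono : ∀ e ∈ E, ∀ e' ∈ E, e ⊆ U → e' ⊆ U → Disjoint e W → Disjoint e' W → c e = c e') :
    ∃ i, M.card ≤ count c M i + W.card := by
  classical
  set M' := M.filter fun e => Disjoint e W with hM'
  have hbad : (M \ M').card ≤ W.card := by
    have hne : ∀ e ∈ M \ M', ∃ v, v ∈ e ∧ v ∈ W := by
      intro e he
      rw [hM', mem_sdiff, mem_filter, not_and] at he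
      exact not_disjoint_iff.1 (he.2 he.1)
    refine card_le_card_of_forall_subsingleton (fun e v => v ∈ e) (fun e he => ?_) fun v _ => ?_
    · obtain ⟨v, hv, hvW⟩ := hne e he
      exact ⟨v, hvW, hv⟩
    · rintro e ⟨he, hve⟩ e' ⟨he', hve'⟩
      by_contra hee
      exact disjoint_left.1 (hM.disj (mem_sdiff.1 he).1 (mem_sdiff.1 he').1 hee) hve hve'
  have hcard : M.card ≤ (M \ M').card + M'.card := card_le_card_sdiff_add_card
  rcases M'.eq_empty_or_nonempty with h | ⟨e, he⟩
  -- Every edge of `M` meets `W` here, so any colour satisfies the bound.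
  · refine ⟨⟨0, hr⟩, hcard.trans ?_⟩
    rw [h] at hbad ⊢
    rw [card_empty]
    omega
  · refine ⟨c e, ?_⟩
    have : M'.card ≤ count c M (c e) := by
      refine card_le_card fun e' he' => ?_
      rw [hM', mem_filter] at he he'
      exact mem_filter.2 ⟨he'.1, hmono _ (hM.subset he'.1) _ (hM.subset he.1)
        (hM.subset_of_mem he'.1) (hM.subset_of_mem he.1) he'.2 he.2⟩
    omega

/-- If no colour admits a large shift, then some few vertices meet all edges except for a
monochromatic set. -/
lemma exists_small_monochromatic {c : Finset α → Fin r} (hE : ∀ e ∈ E, e.card = k) (hk : 3 ≤ k)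
    (b : ℕ) (hbal : ∀ i : Fin r, ∃ W ⊆ U, W.card ≤ b ∧
      Balanced E (U \ W) k fun e => if c e = i then 1 else 0)
    (hdeg : ∀ S ⊆ U, S.card = k - 1 → U.card + 4 * k + 2 * (r * b) ≤ 2 * (nbr E U S).card)
    (hU : 4 * k + r * b ≤ U.card) :
    ∃ W : Finset α, W.card ≤ r * b + r ∧ ∀ e ∈ E, ∀ e' ∈ E, e ⊆ U → e' ⊆ U → Disjoint e W →
      Disjoint e' W → c e = c e' := by
  choose W hWU hWc hW using hbal
  set W₀ := univ.biUnion W with hW₀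
  have hW₀c : W₀.card ≤ r * b := by
    refine (card_biUnion_le_card_mul _ _ b fun i _ => hWc i).trans ?_
    rw [card_univ, Fintype.card_fin]
  have hW₀U : W₀ ⊆ U := biUnion_subset.2 fun i _ => hWU i
  have hcU := card_sdiff_add_card_eq_card hW₀U
  have hlarge : LargeCodegree E (U \ W₀) k := by
    intro S hS hSc
    have h1 := hdeg S (hS.trans sdiff_subset) hSc
    have h2 := card_nbr_le_add (E := E) (U := U) (S := S) (W := W₀)
    omega
  have hb : ∀ i : Fin r, ∃ b, ∀ e ∈ E, ∀ e' ∈ E, e ⊆ U \ W₀ → e' ⊆ U \ W₀ → b ∉ e → b ∉ e' →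
      (if c e = i then (1 : ℤ) else 0) = if c e' = i then 1 else 0 := by
    intro i
    refine ((hW i).mono (sdiff_subset_sdiff Subset.rfl
      (subset_biUnion_of_mem W (mem_univ i)))).exists_const hE hk hlarge (by omega) fun e => ?_
    split_ifs <;> simp
  choose v hv using hb
  refine ⟨W₀ ∪ univ.image v, ?_, fun e he e' he' heU heU' hd hd' => ?_⟩
  · refine (card_union_le _ _).trans (add_le_add hW₀c (card_image_le.trans ?_))
    rw [card_univ, Fintype.card_fin]
  · rw [disjoint_union_right] at hd hd'
    -- The indicator of the colour of `e` is constant on the remaining edges and equals 1 at `e`.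
    have h := hv (c e) e he e' he' (subset_sdiff.2 ⟨heU, hd.1⟩) (subset_sdiff.2 ⟨heU', hd'.1⟩)
      (fun h => disjoint_left.1 hd.2 h (mem_image_of_mem _ (mem_univ _)))
      (fun h => disjoint_left.1 hd'.2 h (mem_image_of_mem _ (mem_univ _)))
    rw [if_pos rfl] at h
    by_contra hne
    rw [if_neg (Ne.symm hne)] at h
    exact one_ne_zero h

set_option maxHeartbeats 800000 in
/-- Colour bias of perfect matchings in `k`-graphs with large codegree. -/
theorem exists_biased_tiling (hk : 3 ≤ k) (hr : 2 ≤ r) {ε : ℝ} (hε : 0 < ε) (hε' : ε ≤ 1 / 2) :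
    ∃ μ : ℝ, 0 < μ ∧ ∃ n₀ : ℕ, ∀ {α : Type*} [DecidableEq α] (E : Finset (Finset α))
      (U : Finset α), (∀ e ∈ E, e.card = k) → n₀ ≤ U.card → k ∣ U.card →
      (∀ S ⊆ U, S.card = k - 1 → (1 / 2 + ε) * U.card ≤ (nbr E U S).card) →
      ∀ c : Finset α → Fin r, ∃ M, Tiles E U M ∧
        ∃ i, (1 + μ) * ((U.card : ℝ) / (r * k)) ≤ count c M i := by
  obtain ⟨m₀, hm₀⟩ := exists_forall_tileable.{_} (k := k) (by omega) (half_pos hε)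
    (by linarith)
  have hk3 : (3 : ℝ) ≤ k := by exact_mod_cast hk
  have hr2 : (2 : ℝ) ≤ r := by exact_mod_cast hr
  have hkpos : (0 : ℝ) < k := by linarith
  have hrpos : (0 : ℝ) < r := by linarith
  -- With `t` about `a * n`, the gadgets of all `r` colours cover about `εn/(4k)` vertices. The
  -- second bound in `n₀` lets the rounding of `t` and the `r` exceptional vertices fit into another
  -- `εn/(4k)`.
  set a : ℝ := ε / (12 * k ^ 2 * r) with ha
  have hapos : 0 < a := by positivity
  have hak : 3 * k * r * a = ε / (4 * k) := by rw [ha]; field_simp; norm_num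
  refine ⟨a * k, by positivity, max (2 * m₀) ⌈16 * k ^ 2 * r / ε⌉₊,
    fun {α} _ E U hE hn hdvd hdeg c => ?_⟩
  rw [max_le_iff, Nat.ceil_le, div_le_iff₀ hε] at hn
  set n : ℝ := (U.card : ℝ) with hndef
  have hn0 : 0 ≤ n := Nat.cast_nonneg _
  set t := ⌈a * n⌉₊ with ht
  have ht1 : a * n ≤ t := Nat.le_ceil _
  have ht2 : (t : ℝ) ≤ a * n + 1 := (Nat.ceil_lt_add_one (by positivity)).le
  -- the total number of exceptional vertices
  have hB : (r * (3 * k * t) : ℝ) + r ≤ ε * n / (2 * k) := by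
    have h1 : (r * (3 * k * t) : ℝ) ≤ ε / (4 * k) * n + 3 * k * r := by
      rw [← hak]
      calc (r * (3 * k * t) : ℝ) ≤ r * (3 * k * (a * n + 1)) := by gcongr
        _ = _ := by ring
    have h2 : (3 * k * r : ℝ) + r ≤ ε / (4 * k) * n := by
      rw [div_mul_eq_mul_div, le_div_iff₀ (by positivity)]
      nlinarith [mul_pos hkpos hrpos, mul_le_mul_of_nonneg_left hk3 (mul_pos hkpos hrpos).le]
    calc _ ≤ ε / (4 * k) * n + ε / (4 * k) * n := by linarith
      _ = _ := by field_simp; ring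
  have hBε : ε * n / (2 * k) ≤ ε * n / 6 := by
    gcongr
    linarith
  have hεn : ε * n ≤ n / 2 := by nlinarith
  have hdeg' : ∀ S ⊆ U, S.card = k - 1 → (1 / 2 + ε / 2) * n ≤ (nbr E U S).card :=
    fun S hS hSc => le_trans (by gcongr; linarith) (hdeg S hS hSc)
  have h4k : 4 * k ≤ ε * n := by
    have : (4 * k : ℝ) ≤ 16 * k ^ 2 * r := by nlinarith [mul_pos hkpos hrpos]
    linarith
  have htile : ∀ W ⊆ U, W.card ≤ 3 * k * t → k ∣ W.card → Tileable E (U \ W) := by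
    intro W hWU hWc hWk
    have hW : (W.card : ℝ) ≤ ε * n / 6 := by
      have h1 : (W.card : ℝ) ≤ 3 * k * t := by exact_mod_cast hWc
      have h2 : (3 * k * t : ℝ) ≤ r * (3 * k * t) := by
        have : (0 : ℝ) ≤ 3 * k * t := by positivity
        nlinarith
      linarith
    have hcU := card_sdiff_add_card_eq_card hWU
    have hcU' : ((U \ W).card : ℝ) + W.card = n := by
      rw [hndef]
      exact_mod_cast hcU
    refine hm₀ E (U \ W) hE ?_ ?_ fun S hS hSc => ?_
    · have : (2 * m₀ : ℝ) ≤ n := by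
        rw [hndef]
        exact_mod_cast hn.1
      have : (m₀ : ℝ) ≤ (U \ W).card := by linarith
      exact_mod_cast this
    · rw [show (U \ W).card = U.card - W.card by omega]
      exact Nat.dvd_sub hdvd hWk
    · have h1 := hdeg S (hS.trans sdiff_subset) hSc
      have h2 : ((nbr E U S).card : ℝ) ≤ (nbr E (U \ W) S).card + W.card := by
        exact_mod_cast card_nbr_le_add
      have h3 : ((U \ W).card : ℝ) ≤ n := by linarith [Nat.cast_nonneg (α := ℝ) W.card]
      have h4 : (1 / 2 + ε / 2) * ((U \ W).card : ℝ) ≤ (1 / 2 + ε / 2) * n := by gcongr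
      linarith
  have hcardM : ∀ M, Tiles E U M → n = k * M.card := fun M hM => by
    rw [hndef]
    exact_mod_cast hM.card hE
  by_cases hshift : ∃ i : Fin r, ∃ W ⊆ U, W.card ≤ 3 * k * t ∧ ∃ P Q, Tiles E W P ∧ Tiles E W Q ∧
      ∑ e ∈ P, (if c e = i then (1 : ℤ) else 0) + t ≤ ∑ e ∈ Q, if c e = i then (1 : ℤ) else 0
  · obtain ⟨i, W, hWU, hWc, P, Q, hP, hQ, hPQ⟩ := hshift
    obtain ⟨M, hM⟩ := htile W hWU hWc ⟨_, hP.card hE⟩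
    have hd : Disjoint (U \ W) W := disjoint_sdiff_self_left
    have hMP := hM.disj_union hP hd
    have hMQ := hM.disj_union hQ hd
    have hsP := hM.sum_union (f := fun e => if c e = i then 1 else 0) hE (by omega) hP hd
    have hsQ := hM.sum_union (f := fun e => if c e = i then 1 else 0) hE (by omega) hQ hd
    rw [sdiff_union_of_subset hWU] at hMP hMQ
    have hc : count c (M ∪ P) i + t ≤ count c (M ∪ Q) i := by
      simp only [sum_ite_eq_count] at hsP hsQ hPQ
      omega
    -- The left side equals `n/k + a * n`, which explains the choice `μ = a * k`.
    have hx : r * ((1 + a * k) * (n / (r * k))) ≤ (M ∪ P).card + t := by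
      have h1 : r * ((1 + a * k) * (n / (r * k))) = n / k + a * n := by
        field_simp
      have h2 : n / k = (M ∪ P).card := by
        rw [hcardM _ hMP]
        field_simp
      rw [h1, h2]
      linarith
    rcases exists_le_count_of_shift hc hx with h | h
    · exact ⟨_, hMP, h⟩
    · exact ⟨_, hMQ, h⟩
  · obtain ⟨M, hM⟩ := htile ∅ (empty_subset _) (by simp) (by simp)
    rw [sdiff_empty] at hM
    have hBn : (r * (3 * k * t) : ℝ) ≤ ε * n / 6 := by linarith
    obtain ⟨W, hWc, hmono⟩ := exists_small_monochromatic (c := c) (U := U) hE hk (3 * k * t)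
      (fun i => (exists_shift_or_balanced hE (by omega) U _ t).resolve_left
        fun h => hshift ⟨i, h⟩) (fun S hS hSc => by
        have h1 := hdeg S hS hSc
        have : (U.card + 4 * k + 2 * (r * (3 * k * t)) : ℝ) ≤ 2 * (nbr E U S).card := by
          linarith
        exact_mod_cast this) (by
        have : (4 * k + r * (3 * k * t) : ℝ) ≤ U.card := by linarith
        exact_mod_cast this)
    obtain ⟨i, hi⟩ := exists_card_le_count_add (by omega) hM hmono
    refine ⟨M, hM, i, ?_⟩
    have h1 : (M.card : ℝ) ≤ count c M i + W.card := by exact_mod_cast hi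
    have h2 : (W.card : ℝ) ≤ r * (3 * k * t) + r := by exact_mod_cast hWc
    have h3 : n / k = M.card := by
      rw [hcardM _ hM]
      field_simp
    -- At least `3/4` of the `n/k` edges share a colour, while `r ≥ 2` and `μ ≤ 1/2` make the target
    -- at most `(3/2) * n/(2k)`.
    have h4 : ε * n / (2 * k) ≤ n / k / 4 := by
      rw [div_div, div_le_div_iff₀ (by positivity) (by positivity)]
      nlinarith
    have h5 : a * k ≤ 1 / 2 := by
      rw [ha, div_mul_eq_mul_div, div_le_iff₀ (by positivity)]
      nlinarith [mul_pos hkpos hrpos, mul_pos (mul_pos hkpos hrpos) hkpos]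
    have h6 : n / (r * k) ≤ n / k / 2 := by
      rw [div_div, mul_comm (r : ℝ)]
      gcongr
    have h7 : (1 + a * k) * (n / (r * k)) ≤ 3 / 2 * (n / (r * k)) := by
      gcongr
      linarith
    linarith

end TilingBias

/-! ### Transfer to `Hypergraph` -/

namespace TilingBias

open Finset

variable {α : Type*}

open Classical in
/-- The edges of a hypergraph inside `U`, as finite sets. -/
noncomputable def finEdges (G : Hypergraph α) (U : Finset α) : Finset (Finset α) :=
  U.powerset.filter fun e => (e : Set α) ∈ G.edgeSet

variable {G : Hypergraph α} {U : Finset α} {k : ℕ}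

lemma mem_finEdges (hU : (U : Set α) = G.vertexSet) {e : Finset α} :
    e ∈ finEdges G U ↔ (e : Set α) ∈ G.edgeSet := by
  simp only [finEdges, mem_filter, mem_powerset, and_iff_right_iff_imp]
  intro h
  have := G.subset_vertexSet_of_mem_edgeSet' h
  rw [← hU] at this
  exact_mod_cast this

lemma card_of_mem_finEdges (hU : (U : Set α) = G.vertexSet) (hG : G.IsUniform k) : ∀ e ∈ finEdges G U, e.card = k := by
  intro e he
  have := hG _ ((mem_finEdges hU).1 he)
  rw [Set.encard_coe_eq_coe_finsetCard] at this
  exact_mod_cast this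

variable [DecidableEq α]

/-- By uniformity, an edge containing a `(k-1)`-set is that set plus one neighbour, so degrees are
bounded by neighbourhood sizes. -/
lemma minSetDegree_le_card_nbr (hU : (U : Set α) = G.vertexSet) (hG : G.IsUniform k) (hk : 0 < k)
    {S : Finset α} (hS : S ⊆ U) (hSc : S.card = k - 1) :
    G.minSetDegree (k - 1) ≤ (nbr (finEdges G U) U S).card := by
  refine le_trans (Nat.sInf_le ⟨(S : Set α), ?_, rfl⟩) ?_
  · refine ⟨?_, ?_⟩
    · rw [← hU]
      exact_mod_cast hS
    · rw [Set.encard_coe_eq_coe_finsetCard, hSc]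
  · rw [Hypergraph.setDegree]
    refine (Set.ncard_le_ncard (t := (((nbr (finEdges G U) U S).image fun v =>
      ((insert v S : Finset α) : Set α) : Finset (Set α)) : Set (Set α))) ?_
      (finite_toSet _)).trans ?_
    · rintro e ⟨he, hSe⟩
      have heU := G.subset_vertexSet_of_mem_edgeSet' he
      rw [← hU] at heU
      obtain ⟨e, rfl⟩ := (U.finite_toSet.subset heU).exists_finset_coe
      rw [coe_subset] at hSe heU
      have hek := card_of_mem_finEdges hU hG e ((mem_finEdges hU).2 he)
      obtain ⟨v, hv⟩ : ∃ v, e \ S = {v} := by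
        rw [← card_eq_one, card_sdiff_of_subset hSe]
        omega
      have hve : v ∈ e \ S := by rw [hv]; exact mem_singleton_self v
      rw [mem_sdiff] at hve
      have hins : insert v S = e := by
        rw [insert_eq, ← hv, sdiff_union_of_subset hSe]
      rw [mem_coe, mem_image]
      refine ⟨v, mem_nbr.2 ⟨heU hve.1, hve.2, ?_⟩, by rw [hins]⟩
      rw [hins]
      exact (mem_finEdges hU).2 he
    · rw [Set.ncard_coe_finset]
      exact card_image_le

lemma Tiles.isPerfectMatching (hU : (U : Set α) = G.vertexSet) {M : Finset (Finset α)}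
    (hM : Tiles (finEdges G U) U M) :
    G.IsPerfectMatching ((fun e : Finset α => (e : Set α)) '' M) := by
  refine ⟨?_, ?_, ?_⟩
  · rintro _ ⟨e, he, rfl⟩
    exact (mem_finEdges hU).1 (hM.subset he)
  · rintro _ ⟨e, he, rfl⟩ _ ⟨e', he', rfl⟩ hne
    exact disjoint_coe.2 (hM.disj he he' fun h => hne (by rw [h]))
  · rw [← hU, Set.sUnion_image, ← hM.union, coe_biUnion]
    rfl

lemma count_le_colourCount (hU : (U : Set α) = G.vertexSet) {r : ℕ} {M : Finset (Finset α)}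
    (hM : Tiles (finEdges G U) U M) {c : G.edgeSet → Fin r} {c' : Finset α → Fin r}
    (hc : ∀ (e : Finset α) (h : (e : Set α) ∈ G.edgeSet), c' e = c ⟨e, h⟩) (i : Fin r) :
    count c' M i ≤ G.colourCount c ((fun e : Finset α => (e : Set α)) '' M) i := by
  have hfin : G.edgeSet.Finite := U.powerset.finite_toSet.image (fun e : Finset α => (e : Set α)) |>.subset
    fun e he => by
      have heU := G.subset_vertexSet_of_mem_edgeSet' he
      rw [← hU] at heU
      obtain ⟨e, rfl⟩ := (U.finite_toSet.subset heU).exists_finset_coe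
      exact ⟨e, mem_coe.2 (mem_powerset.2 (coe_subset.1 heU)), rfl⟩
  have := hfin.to_subtype
  rw [count, ← Set.ncard_coe_finset, Hypergraph.colourCount,
    ← Set.ncard_image_of_injective _ coe_injective,
    ← Set.ncard_image_of_injective _ Subtype.val_injective]
  refine Set.ncard_le_ncard ?_ ((Set.toFinite _).image _)
  rintro _ ⟨e, he, rfl⟩
  rw [mem_coe, mem_filter] at he
  have heG := (mem_finEdges hU).1 (hM.subset he.1)
  exact ⟨⟨e, heG⟩, ⟨⟨e, he.1, rfl⟩, (hc e heG).symm.trans he.2⟩, rfl⟩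

end TilingBias

open TilingBias in
theorem corollary1p2 (k r : ℕ) (hk : 3 ≤ k) (hr : 2 ≤ r) (ε : ℝ) (hε : 0 < ε) :
    ∃ μ : ℝ, 0 < μ ∧ ∃ n₀ : ℕ, ∀ n : ℕ, n₀ ≤ n → k ∣ n →
      ∀ (α : Type*) (G : Hypergraph α), G.IsUniform k → G.vertexSet.encard = n →
        (1 / 2 + ε) * (n : ℝ) ≤ (G.minSetDegree (k - 1) : ℝ) →
        ∀ c : G.edgeSet → Fin r,
          ∃ M : Set (Set α), G.IsPerfectMatching M ∧
            ∃ i : Fin r, (1 + μ) * ((n : ℝ) / ((r : ℝ) * (k : ℝ))) ≤ (G.colourCount c M i : ℝ) := by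
  -- Lowering `ε` to at most `1/2` only weakens the degree condition.
  obtain ⟨μ, hμ, n₀, h⟩ := exists_biased_tiling.{_} hk hr (lt_min hε one_half_pos)
    (min_le_right ε (1 / 2))
  refine ⟨μ, hμ, n₀, fun n hn hkn α G hG hGn hdeg c => ?_⟩
  classical
  obtain ⟨U, hU⟩ := (Set.finite_of_encard_eq_coe hGn).exists_finset_coe
  have hUn : U.card = n := by
    rw [← hU, Set.encard_coe_eq_coe_finsetCard] at hGn
    exact_mod_cast hGn
  subst hUn
  obtain ⟨M, hM, i, hi⟩ := h (finEdges G U) U (card_of_mem_finEdges hU hG) hn hkn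
    (fun S hS hSc => by
      have h1 : (G.minSetDegree (k - 1) : ℝ) ≤ (nbr (finEdges G U) U S).card := by
        exact_mod_cast minSetDegree_le_card_nbr hU hG (by omega) hS hSc
      refine le_trans ?_ (hdeg.trans h1)
      gcongr
      exact min_le_left _ _)
    -- The colour 0 given to non-edges is never counted, since tilings consist of edges.
    (fun e => if he : (e : Set α) ∈ G.edgeSet then c ⟨e, he⟩ else ⟨0, by omega⟩)
  refine ⟨_, hM.isPerfectMatching hU, i, hi.trans ?_⟩
  exact_mod_cast count_le_colourCount hU hM (fun e he => dif_pos he) i
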